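/- For $n\ge 0$ let $\mathsf{MAJ}_n:\{0,1\}^n\to\{0,1\}$ be the function with $\mathsf{MAJ}_n(x)=1$ if and only if $x_1+\dots+x_n>n/2$, and let $\mathsf{MAJ}_n\circ\mathsf{XOR}$ be the function of $2n$ Boolean variables given by $$(x,y)\mapsto \mathsf{MAJ}_n(x_1\oplus y_1,\dots,x_n\oplus y_n).$$ A $\mathsf{MAJ}\circ\mathsf{MAJ}$ circuit consists of a bottom layer of majority gates, each of whose inputs is a constant, a variable or a negated variable (repetitions allowed), and one top majority gate, each of whose inputs is a constant, the output of a bottom gate or the negation of such an output (repetitions allowed). Here a majority gate with $m$ inputs computes $\mathsf{MAJ}_m$. The size of the circuit is its number of gates plus its number of wires. A linear threshold function is a Boolean function of the form $z\mapsto[\,w_0+\sum_i w_iz_i>0\,]$ with arbitrary real weights $w_i$. A linear decision list of size $k\ge 1$ is a sequence $(L_1,a_1),\dots,(L_k,a_k)$ in which every $L_i$ is a linear threshold function, $L_k$ is the constant $1$, and $a_i\in\{0,1\}$; on input $z$ it outputs $a_i$ for the least $i$ with $L_i(z)=1$. Then the following hold. 1. There is a constant $K$ such that for every $n\ge 1$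 the function $\mathsf{MAJ}_n\circ\mathsf{XOR}$ is computed by a $\mathsf{MAJ}\circ\mathsf{MAJ}$ circuit of size at most $Kn$. 2. For every $n\ge 0$, every linear decision list that computes $\mathsf{MAJ}_n\circ\mathsf{XOR}$ has size at least $2^{0.18\,n}$. In particular, there is a family of functions that is computed by polynomial-size (even linear-size) $\mathsf{MAJ}\circ\mathsf{MAJ}$ circuits, while every linear decision list computing it has exponential size. -/

import Mathlib

namespace ThresholdCircuits

/-- The sign function `ℝ → {0,1}`: it is `1` on positive reals and `0` on all others. -/
noncomputable def sign (r : ℝ) : Bool := decide (0 < r)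

/-- A bit as a real number. -/
def bit (b : Bool) : ℝ := if b then 1 else 0

/-- Linear threshold functions of Boolean variables indexed by a finite type, with arbitrary real
weights. -/
def IsLTF {ι : Type} [Fintype ι] (f : (ι → Bool) → Bool) : Prop :=
  ∃ (w₀ : ℝ) (w : ι → ℝ), ∀ x, f x = sign (w₀ + ∑ i, w i * bit (x i))

/-- The majority function `MAJ_n(x) = sign(x_1 + ... + x_n - n/2)`. -/
noncomputable def MAJ (n : ℕ) (x : Fin n → Bool) : Bool :=
  sign ((∑ i, bit (x i)) - (n : ℝ) / 2)

/-- `f ∘ XOR`, a function of the `2n` variables `x_1, ..., x_n` (the left summand) and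
`y_1, ..., y_n` (the right summand). -/
def compXOR {n : ℕ} (f : (Fin n → Bool) → Bool) (z : Fin n ⊕ Fin n → Bool) : Bool :=
  f fun i => xor (z (Sum.inl i)) (z (Sum.inr i))

/-- A linear decision list `(L_1, a_1), ..., (L_k, a_k)` of size `k`: each `L_i` is a linear
threshold function, and the last one is the constant `1`. -/
structure LinearDecisionList (ι : Type) [Fintype ι] where
  size : ℕ
  size_pos : 0 < size
  query : Fin size → (ι → Bool) → Bool
  isLTF_query : ∀ i, IsLTF (query i)
  answer : Fin size → Bool
  query_last : ∀ x, query ⟨size - 1, Nat.sub_one_lt_of_lt size_pos⟩ x = true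

open Classical in
/-- The output of a linear decision list: the answer at the first query that evaluates to `1`,
that is, `⋁ i, (a_i ∧ L_i(x) ∧ ⋀ j < i, ¬ L_j(x))`. -/
noncomputable def LinearDecisionList.eval {ι : Type} [Fintype ι] (D : LinearDecisionList ι)
    (x : ι → Bool) : Bool :=
  decide (∃ i, D.answer i = true ∧ D.query i x = true ∧ ∀ j < i, D.query j x = false)

/-- `D` computes `f`. -/
def LinearDecisionList.Computes {ι : Type} [Fintype ι] (D : LinearDecisionList ι)
    (f : (ι → Bool) → Bool) : Prop :=
  ∀ x, D.eval x = f x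

/-- What may be fed into one input of a majority gate: a constant, a variable or a negated
variable. -/
inductive GateInput (ι : Type) where
  | const (b : Bool)
  | pos (i : ι)
  | neg (i : ι)

/-- The bit carried by a gate input. -/
def GateInput.eval {ι : Type} (x : ι → Bool) : GateInput ι → Bool
  | .const b => b
  | .pos i => x i
  | .neg i => !(x i)

/-- A majority gate over the variables `ι`. The same variable may be fed in several times; each
occurrence counts towards the fan-in. -/
structure MajGate (ι : Type) where
  fanIn : ℕ
  input : Fin fanIn → GateInput ι

/-- The function computed by a majority gate. -/
noncomputable def MajGate.eval {ι : Type} (g : MajGate ι) (x : ι → Bool) : Bool :=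
  MAJ g.fanIn fun j => (g.input j).eval x

/-- A depth-two `MAJ ∘ MAJ` circuit: a bottom layer of majority gates over the variables, and one
majority gate on top over their outputs. -/
structure MajMajCircuit (ι : Type) where
  width : ℕ
  bottom : Fin width → MajGate ι
  top : MajGate (Fin width)

/-- The function computed by a `MAJ ∘ MAJ` circuit. -/
noncomputable def MajMajCircuit.eval {ι : Type} (C : MajMajCircuit ι) (x : ι → Bool) : Bool :=
  C.top.eval fun k => (C.bottom k).eval x

/-- The size of a `MAJ ∘ MAJ` circuit: the number of gates plus the number of wires. -/
def MajMajCircuit.size {ι : Type} (C : MajMajCircuit ι) : ℕ :=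
  (1 + C.width) + (C.top.fanIn + ∑ k, (C.bottom k).fanIn)

/-- `C` computes `f`. -/
def MajMajCircuit.Computes {ι : Type} (C : MajMajCircuit ι) (f : (ι → Bool) → Bool) : Prop :=
  ∀ x, C.eval x = f x

end ThresholdCircuits

/-!
**Upper bound.** As `a ⊕ b = (a ∨ b) + ¬(a ∧ b) - 1`, the inequality `∑ (xᵢ ⊕ yᵢ) > n / 2` says that
the `2n` bits `xᵢ ∨ yᵢ` and `¬(xᵢ ∧ yᵢ)` have sum more than `3n / 2`. With `n` constants `0` added
this is a majority of `3n` bits, and `∨`, `∧` of two bits are majorities of three.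

**Lower bound.** On inputs `(x, y)` a linear threshold function has the form `[A x + B y > 0]`. Cutting
rows and columns at the `t`-th largest values of `A` and `B`, one finds either a rectangle with more
than `t` rows and columns on which the function is `1`, or, after deleting at most `t` rows and `t`
columns, a rectangle on which it is `0` (`exists_pos_or_nonpos_rectangle`). Applying this to the
queries of a decision list one after the other shows that a list of size `k` with `k * t < 2 ^ n` has
a monochromatic rectangle with more than `t` rows and columns
(`LinearDecisionList.card_le_size_mul`): the peeling cannot survive the last query.

On the other side, a monochromatic rectangle of `MAJ ∘ XOR` is, up to complementing all its columns,
a pair of sets at Hamming distance at least `n / 2`, and such sets satisfy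
`|R| |S| ≤ (16 / 3) ^ n / 3 ^ (n / 2)` (`card_mul_card_le`). This comes from a two-function
inequality that tensorises over the coordinates, `sum_mul_sum_le`; the base `3` optimises the
result, and gives the same exponent as the isoperimetric inequality, `1 - H(1/4) ≈ 0.1887`. Together,
`k ≥ (27 / 16) ^ (n / 4) ≥ 2 ^ (0.18 n)`.
-/

namespace ThresholdCircuits

/-! ### A linear-size depth-two majority circuit -/

/-- The majority gate with inputs `xᵢ`, `yᵢ` and the constant `c`: it computes `xᵢ ∨ yᵢ` for `c = 1`
and `xᵢ ∧ yᵢ` for `c = 0`. -/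
def pairGate {n : ℕ} (c : Bool) (i : Fin n) : MajGate (Fin n ⊕ Fin n) where
  fanIn := 3
  input := ![.pos (Sum.inl i), .pos (Sum.inr i), .const c]

theorem MajGate.eval_mk {ι : Type} (m : ℕ) (input : Fin m → GateInput ι) (x : ι → Bool) :
    (MajGate.mk m input).eval x = sign ((∑ j, bit ((input j).eval x)) - (m : ℝ) / 2) := rfl

theorem pairGate_true_eval {n : ℕ} (i : Fin n) (z : Fin n ⊕ Fin n → Bool) :
    (pairGate true i).eval z = (z (Sum.inl i) || z (Sum.inr i)) := by
  rw [pairGate, MajGate.eval_mk, Fin.sum_univ_three]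
  cases h₁ : z (Sum.inl i) <;> cases h₂ : z (Sum.inr i) <;>
    simp [sign, GateInput.eval, h₁, h₂, bit] <;> norm_num

theorem pairGate_false_eval {n : ℕ} (i : Fin n) (z : Fin n ⊕ Fin n → Bool) :
    (pairGate false i).eval z = (z (Sum.inl i) && z (Sum.inr i)) := by
  rw [pairGate, MajGate.eval_mk, Fin.sum_univ_three]
  cases h₁ : z (Sum.inl i) <;> cases h₂ : z (Sum.inr i) <;>
    simp [sign, GateInput.eval, h₁, h₂, bit] <;> norm_num

/-- The circuit for `MAJ ∘ XOR`: its top gate receives the bits `xᵢ ∨ yᵢ`, the bits `¬(xᵢ ∧ yᵢ)` and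
`n` constants `0`. -/
def majXorCircuit (n : ℕ) : MajMajCircuit (Fin n ⊕ Fin n) where
  width := n + n
  bottom := Fin.addCases (pairGate true) (pairGate false)
  top :=
    { fanIn := (n + n) + n
      input := Fin.addCases
        (Fin.addCases (fun i => .pos (Fin.castAdd n i)) (fun i => .neg (Fin.natAdd n i)))
        (fun _ => .const false) }

theorem majXorCircuit_size (n : ℕ) : (majXorCircuit n).size = 11 * n + 1 := by
  change (1 + (n + n)) + ((n + n) + n + ∑ k : Fin (n + n), ((majXorCircuit n).bottom k).fanIn) = _
  have h : ∀ k : Fin (n + n), ((majXorCircuit n).bottom k).fanIn = 3 := fun k => by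
    refine Fin.addCases (fun i => ?_) (fun i => ?_) k <;>
      simp only [majXorCircuit, Fin.addCases_left, Fin.addCases_right, pairGate]
  simp only [h, Finset.sum_const, Finset.card_univ, Fintype.card_fin, smul_eq_mul]
  ring

theorem bit_or_add_bit_not_and (a b : Bool) : bit (a || b) + bit (!(a && b)) = bit (xor a b) + 1 := by
  cases a <;> cases b <;> simp [bit]

theorem majXorCircuit_computes (n : ℕ) : (majXorCircuit n).Computes (compXOR (MAJ n)) := by
  intro z
  have hsum : (∑ i, bit (z (Sum.inl i) || z (Sum.inr i))) +
      (∑ i, bit (!(z (Sum.inl i) && z (Sum.inr i)))) =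
      (∑ i, bit (xor (z (Sum.inl i)) (z (Sum.inr i)))) + n := by
    rw [← Finset.sum_add_distrib, Finset.sum_congr rfl fun i _ => bit_or_add_bit_not_and _ _,
      Finset.sum_add_distrib]
    simp
  have htop : (majXorCircuit n).eval z = sign ((∑ j : Fin ((n + n) + n), bit (GateInput.eval
      (fun k : Fin (n + n) => (Fin.addCases (pairGate true) (pairGate false) k : MajGate _).eval z)
      (Fin.addCases (Fin.addCases (fun i => .pos (Fin.castAdd n i)) fun i => .neg (Fin.natAdd n i))
        (fun _ => .const false) j))) - (((n + n) + n : ℕ) : ℝ) / 2) := rfl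
  rw [htop, Fin.sum_univ_add, Fin.sum_univ_add]
  simp only [Fin.addCases_left, Fin.addCases_right, GateInput.eval, pairGate_true_eval,
    pairGate_false_eval, hsum, compXOR, MAJ]
  congr 1
  simp only [bit, Bool.false_eq_true, if_false, Finset.sum_const_zero]
  push_cast
  ring

/-! ### Monochromatic rectangles of linear decision lists -/

/-- A cut of `R` at its `t`-th largest value of `A`: more than `t` elements have value at least the
cut, and at most `t` have value above it. -/
theorem exists_quantile {α : Type*} (A : α → ℝ) (R : Finset α) (t : ℕ) (h : t < R.card) :
    ∃ a : ℝ, t < (R.filter fun x => a ≤ A x).card ∧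
      R.card ≤ (R.filter fun x => A x ≤ a).card + t := by
  classical
  -- The cut is the largest value of `A` that more than `t` elements reach.
  obtain ⟨x₀, hx₀, hmin⟩ := R.exists_min_image A (Finset.card_pos.1 (by omega))
  have hne : (R.filter fun x => t < (R.filter fun x' => A x ≤ A x').card).Nonempty := by
    refine ⟨x₀, Finset.mem_filter.2 ⟨hx₀, ?_⟩⟩
    rwa [Finset.filter_true_of_mem hmin]
  obtain ⟨x, hx, hmax⟩ := Finset.exists_max_image _ A hne
  have hx' := Finset.mem_filter.1 hx
  refine ⟨A x, hx'.2, ?_⟩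
  by_contra hcon
  have hsplit := R.card_filter_add_card_filter_not (fun x' => A x' ≤ A x)
  have hbig : t < (R.filter fun x' => ¬ A x' ≤ A x).card := by omega
  obtain ⟨y, hy, hymin⟩ := Finset.exists_min_image (R.filter fun x' => ¬ A x' ≤ A x) A
    (Finset.card_pos.1 (by omega))
  have hy' := Finset.mem_filter.1 hy
  refine hy'.2 (hmax y (Finset.mem_filter.2 ⟨hy'.1, hbig.trans_le (Finset.card_le_card ?_)⟩))
  exact fun w hw => Finset.mem_filter.2 ⟨(Finset.mem_filter.1 hw).1, hymin w hw⟩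

theorem exists_pos_or_nonpos_rectangle {α β : Type*} (A : α → ℝ) (B : β → ℝ) (R : Finset α)
    (S : Finset β) (t : ℕ) :
    (∃ R' ⊆ R, ∃ S' ⊆ S, t < R'.card ∧ t < S'.card ∧ ∀ x ∈ R', ∀ y ∈ S', 0 < A x + B y) ∨
      ∃ R' ⊆ R, ∃ S' ⊆ S, R.card ≤ R'.card + t ∧ S.card ≤ S'.card + t ∧
        ∀ x ∈ R', ∀ y ∈ S', A x + B y ≤ 0 := by
  rcases le_or_gt R.card t with hR | hR
  · exact .inr ⟨∅, by simp, S, subset_rfl, by simpa, by simp, by simp⟩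
  rcases le_or_gt S.card t with hS | hS
  · exact .inr ⟨R, subset_rfl, ∅, by simp, by simp, by simpa, by simp⟩
  obtain ⟨a, ha₁, ha₂⟩ := exists_quantile A R t hR
  obtain ⟨b, hb₁, hb₂⟩ := exists_quantile B S t hS
  rcases lt_or_ge 0 (a + b) with hab | hab
  · refine .inl ⟨_, Finset.filter_subset _ _, _, Finset.filter_subset _ _, ha₁, hb₁, ?_⟩
    intro x hx y hy
    linarith [(Finset.mem_filter.1 hx).2, (Finset.mem_filter.1 hy).2]
  · refine .inr ⟨_, Finset.filter_subset _ _, _, Finset.filter_subset _ _, ha₂, hb₂, ?_⟩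
    intro x hx y hy
    linarith [(Finset.mem_filter.1 hx).2, (Finset.mem_filter.1 hy).2]

/-- A linear threshold function of two groups of variables is a threshold of a sum of a function of
the rows and a function of the columns. -/
theorem IsLTF.exists_add {ι κ : Type} [Fintype ι] [Fintype κ] {f : (ι ⊕ κ → Bool) → Bool}
    (hf : IsLTF f) : ∃ (A : (ι → Bool) → ℝ) (B : (κ → Bool) → ℝ),
      ∀ x y, f (Sum.elim x y) = sign (A x + B y) := by
  obtain ⟨w₀, w, hw⟩ := hf
  refine ⟨fun x => w₀ + ∑ i, w (.inl i) * bit (x i), fun y => ∑ j, w (.inr j) * bit (y j), ?_⟩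
  intro x y
  rw [hw, Fintype.sum_sum_type, add_assoc]
  rfl

theorem LinearDecisionList.eval_eq_answer {ι : Type} [Fintype ι] (D : LinearDecisionList ι)
    {x : ι → Bool} {i : Fin D.size} (hi : D.query i x = true)
    (hlt : ∀ j < i, D.query j x = false) : D.eval x = D.answer i := by
  rw [LinearDecisionList.eval, Bool.eq_iff_iff, decide_eq_true_iff]
  refine ⟨?_, fun h => ⟨i, h, hi, hlt⟩⟩
  rintro ⟨i', ha, hi', hlt'⟩
  have : i' = i := by
    rcases lt_trichotomy i' i with h | h | h
    · simp [hlt _ h] at hi'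
    · exact h
    · simp [hlt' _ h] at hi
  rwa [← this]

/-- If every monochromatic rectangle of `D` has a side of length at most `t`, then the first `j` queries
vanish on what is left after deleting at most `j * t` suitable rows and columns. -/
theorem LinearDecisionList.exists_rectangle_query_eq_false {ι κ : Type} [Fintype ι] [Fintype κ]
    [DecidableEq ι] [DecidableEq κ] (D : LinearDecisionList (ι ⊕ κ)) (t : ℕ)
    (hmono : ∀ (R : Finset (ι → Bool)) (S : Finset (κ → Bool)) (b : Bool),
      (∀ x ∈ R, ∀ y ∈ S, D.eval (Sum.elim x y) = b) → R.card ≤ t ∨ S.card ≤ t)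
    (j : ℕ) (hj : j ≤ D.size) :
    ∃ (R : Finset (ι → Bool)) (S : Finset (κ → Bool)),
      2 ^ Fintype.card ι ≤ R.card + j * t ∧ 2 ^ Fintype.card κ ≤ S.card + j * t ∧
      ∀ x ∈ R, ∀ y ∈ S, ∀ i : Fin D.size, i.1 < j → D.query i (Sum.elim x y) = false := by
  induction j with
  | zero => exact ⟨Finset.univ, Finset.univ, by simp, by simp, by simp⟩
  | succ j ih =>
    obtain ⟨R, S, hR, hS, hq⟩ := ih (by omega)
    obtain ⟨A, B, hAB⟩ := (D.isLTF_query ⟨j, hj⟩).exists_add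
    rcases exists_pos_or_nonpos_rectangle A B R S t with
      ⟨R', hR', S', hS', hRc, hSc, hpos⟩ | ⟨R', hR', S', hS', hRc, hSc, hneg⟩
    · have := hmono R' S' (D.answer ⟨j, hj⟩) fun x hx y hy => by
        refine D.eval_eq_answer ?_ fun i hi => hq x (hR' hx) y (hS' hy) i hi
        rw [hAB, sign, decide_eq_true_iff]
        exact hpos x hx y hy
      omega
    · refine ⟨R', S', by rw [add_one_mul]; omega, by rw [add_one_mul]; omega, ?_⟩
      intro x hx y hy i hi
      rcases (Nat.lt_succ_iff_lt_or_eq.1 hi) with hlt | heq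
      · exact hq x (hR' hx) y (hS' hy) i hlt
      · obtain rfl : i = ⟨j, hj⟩ := Fin.ext heq
        rw [hAB, sign, decide_eq_false_iff_not]
        exact not_lt.2 (hneg x hx y hy)

/-- A function all of whose monochromatic rectangles have a side of length at most `t` needs linear
decision lists of size at least `2 ^ n / t`. -/
theorem LinearDecisionList.card_le_size_mul {ι : Type} [Fintype ι] [DecidableEq ι]
    (D : LinearDecisionList (ι ⊕ ι)) (t : ℕ)
    (hmono : ∀ (R S : Finset (ι → Bool)) (b : Bool),
      (∀ x ∈ R, ∀ y ∈ S, D.eval (Sum.elim x y) = b) → R.card ≤ t ∨ S.card ≤ t) :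
    2 ^ Fintype.card ι ≤ D.size * t := by
  obtain ⟨R, S, hR, hS, hq⟩ := D.exists_rectangle_query_eq_false t hmono D.size le_rfl
  by_contra hcon
  obtain ⟨x, hx⟩ := Finset.card_pos.1 (show 0 < R.card by omega)
  obtain ⟨y, hy⟩ := Finset.card_pos.1 (show 0 < S.card by omega)
  have := hq x hx y hy ⟨D.size - 1, Nat.sub_one_lt_of_lt D.size_pos⟩
    (Nat.sub_one_lt_of_lt D.size_pos)
  simp [D.query_last] at this

/-! ### Distant sets in the Hamming cube -/

/-- Two numbers at most `3c` with product at most `c ^ 2` have sum at most `3c + c / 3`. -/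
theorem add_le_of_mul_le {u v c : ℝ} (hu3 : u ≤ 3 * c) (hv3 : v ≤ 3 * c)
    (huv : u * v ≤ c * c) : u + v ≤ 10 / 3 * c := by
  rcases le_or_gt (3 * u) c with h | h
  · linarith
  · have hu' : 0 < u := by linarith
    have : u * (u + v) ≤ u * (10 / 3 * c) := by
      -- `u` lies between the roots `c / 3` and `3 * c` of `u ^ 2 - 10 / 3 * c * u + c ^ 2`.
      nlinarith [mul_nonneg (sub_nonneg.2 hu3) (sub_nonneg.2 h.le)]
    exact le_of_mul_le_mul_left this hu'

/-- The case of one coordinate, where the product of the sums is `f₀ g₀ + f₁ g₁ + f₀ g₁ + f₁ g₀` and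
the last two summands have product at most `c ^ 2`. -/
theorem add_mul_add_le {f₀ f₁ g₀ g₁ c : ℝ} (hf₀ : 0 ≤ f₀) (hf₁ : 0 ≤ f₁) (hg₀ : 0 ≤ g₀)
    (hg₁ : 0 ≤ g₁) (h₀₀ : f₀ * g₀ ≤ c) (h₁₁ : f₁ * g₁ ≤ c) (h₀₁ : f₀ * g₁ ≤ 3 * c)
    (h₁₀ : f₁ * g₀ ≤ 3 * c) : (f₀ + f₁) * (g₀ + g₁) ≤ 16 / 3 * c := by
  have hc : 0 ≤ c := (mul_nonneg hf₀ hg₀).trans h₀₀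
  have := add_le_of_mul_le h₀₁ h₁₀ (by
    calc f₀ * g₁ * (f₁ * g₀) = f₀ * g₀ * (f₁ * g₁) := by ring
      _ ≤ c * c := mul_le_mul h₀₀ h₁₁ (mul_nonneg hf₁ hg₁) hc)
  linarith

theorem sum_cube_succ {n : ℕ} (f : (Fin (n + 1) → Bool) → ℝ) :
    ∑ x, f x = (∑ x, f (Fin.cons false x)) + ∑ x, f (Fin.cons true x) := by
  rw [← (Fin.consEquiv fun _ => Bool).sum_comp, Fintype.sum_prod_type, Fintype.sum_bool, add_comm]
  rfl

theorem hammingDist_cons {n : ℕ} (a b : Bool) (x y : Fin n → Bool) :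
    hammingDist (Fin.cons a x : Fin (n + 1) → Bool) (Fin.cons b y) =
      (if a = b then 0 else 1) + hammingDist x y := by
  simp only [hammingDist, Finset.card_filter, Fin.sum_univ_succ, Fin.cons_zero, Fin.cons_succ]
  by_cases h : a = b <;> simp [h]

/-- A discrete two-function inequality of Prékopa–Leindler type on the cube; the induction over the
coordinates carries a constant `c`, which absorbs the factors split off. -/
theorem sum_mul_sum_le (n : ℕ) (c : ℝ) (f g : (Fin n → Bool) → ℝ) (hf : ∀ x, 0 ≤ f x)
    (hg : ∀ x, 0 ≤ g x) (h : ∀ x y, f x * g y ≤ 3 ^ hammingDist x y * c) :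
    (∑ x, f x) * ∑ y, g y ≤ (16 / 3) ^ n * c := by
  induction n generalizing c with
  | zero =>
    rw [Fintype.sum_unique, Fintype.sum_unique, pow_zero]
    exact (h _ _).trans_eq (by rw [hammingDist_self, pow_zero])
  | succ n ih =>
    have key : ∀ a b : Bool, (∑ x, f (Fin.cons a x)) * ∑ y, g (Fin.cons b y) ≤
        (16 / 3) ^ n * (3 ^ (if a = b then 0 else 1) * c) := fun a b => by
      refine ih _ _ _ (fun _ => hf _) (fun _ => hg _) fun x y => (h _ _).trans_eq ?_
      rw [hammingDist_cons, pow_add]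
      ring
    have h₀₀ := key false false
    have h₁₁ := key true true
    have h₀₁ := key false true
    have h₁₀ := key true false
    simp only [reduceIte, Bool.false_eq_true, Bool.true_eq_false, pow_zero, pow_one, one_mul]
      at h₀₀ h₁₁ h₀₁ h₁₀
    rw [mul_left_comm] at h₀₁ h₁₀
    rw [sum_cube_succ, sum_cube_succ, pow_succ', mul_assoc]
    exact add_mul_add_le (Finset.sum_nonneg fun _ _ => hf _) (Finset.sum_nonneg fun _ _ => hf _)
      (Finset.sum_nonneg fun _ _ => hg _) (Finset.sum_nonneg fun _ _ => hg _) h₀₀ h₁₁ h₀₁ h₁₀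

/-- Sets at Hamming distance at least `n / 2` in the `n`-cube are small; the bound is squared to avoid
the exponent `n / 2`. -/
theorem card_mul_card_le {n : ℕ} (R S : Finset (Fin n → Bool))
    (h : ∀ x ∈ R, ∀ y ∈ S, n ≤ 2 * hammingDist x y) :
    ((R.card : ℝ) * S.card) ^ 2 * 27 ^ n ≤ 256 ^ n := by
  classical
  have h3 : (0 : ℝ) < √3 := by positivity
  have hsq : √3 ^ 2 = (3 : ℝ) := Real.sq_sqrt (by norm_num)
  have h1 : (1 : ℝ) ≤ √3 := Real.one_le_sqrt.2 (by norm_num)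
  -- The rescaled indicators of `R` and `S` satisfy the hypothesis of `sum_mul_sum_le`.
  have key := sum_mul_sum_le n 1 (fun x => if x ∈ R then √3 ^ n else 0)
    (fun y => if y ∈ S then 1 else 0) (fun x => by positivity) (fun y => by positivity) (by
      intro x y
      by_cases hx : x ∈ R
      · by_cases hy : y ∈ S
        · simp only [hx, hy, if_true, mul_one]
          calc √3 ^ n ≤ √3 ^ (2 * hammingDist x y) := pow_le_pow_right₀ h1 (h x hx y hy)
            _ = 3 ^ hammingDist x y := by rw [pow_mul, hsq]
        · simp [hy]
      · simp [hx])
  simp only [Finset.sum_ite_mem, Finset.univ_inter, Finset.sum_const, nsmul_eq_mul, mul_one] at key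
  have hpow := pow_le_pow_left₀ (by positivity) key 2
  have h27 : (27 : ℝ) ^ n = (√3 ^ n) ^ 2 * 9 ^ n := by
    rw [← pow_mul, mul_comm n 2, pow_mul, hsq, ← mul_pow]; norm_num
  have h256 : (256 : ℝ) ^ n = ((16 / 3) ^ n) ^ 2 * 9 ^ n := by
    rw [← pow_mul, mul_comm n 2, pow_mul, ← mul_pow]; norm_num
  rw [h27, h256]
  calc ((R.card : ℝ) * S.card) ^ 2 * ((√3 ^ n) ^ 2 * 9 ^ n)
      = ((R.card : ℝ) * √3 ^ n * S.card) ^ 2 * 9 ^ n := by ring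
    _ ≤ _ := mul_le_mul_of_nonneg_right hpow (by positivity)

/-! ### Linear decision lists for majority of parities -/

theorem sum_bit_xor_eq_hammingDist {n : ℕ} (x y : Fin n → Bool) :
    ∑ i, bit (xor (x i) (y i)) = hammingDist x y := by
  rw [hammingDist, Finset.card_filter]
  push_cast
  exact Finset.sum_congr rfl fun i _ => by cases x i <;> cases y i <;> simp [bit]

theorem compXOR_MAJ_eq_true_iff {n : ℕ} (x y : Fin n → Bool) :
    compXOR (MAJ n) (Sum.elim x y) = true ↔ n < 2 * hammingDist x y := by
  simp only [compXOR, MAJ, sign, Sum.elim_inl, Sum.elim_inr, decide_eq_true_iff,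
    sum_bit_xor_eq_hammingDist]
  rw [← Nat.cast_lt (α := ℝ)]
  push_cast
  constructor <;> intro h <;> linarith

theorem hammingDist_add_hammingDist_not {n : ℕ} (x y : Fin n → Bool) :
    hammingDist x y + hammingDist x (fun i => !(y i)) = n := by
  simp only [hammingDist, Finset.card_filter, ← Finset.sum_add_distrib]
  rw [Finset.sum_congr rfl (g := fun _ => 1) fun i _ => by cases x i <;> cases y i <;> simp]
  simp

theorem card_mul_card_le_of_monochromatic {n : ℕ} (R S : Finset (Fin n → Bool)) (b : Bool)
    (h : ∀ x ∈ R, ∀ y ∈ S, compXOR (MAJ n) (Sum.elim x y) = b) :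
    ((R.card : ℝ) * S.card) ^ 2 * 27 ^ n ≤ 256 ^ n := by
  cases b with
  | true => exact card_mul_card_le R S fun x hx y hy =>
      ((compXOR_MAJ_eq_true_iff x y).1 (h x hx y hy)).le
  | false =>
    -- Complementing the columns turns distances at most `n / 2` into distances at least `n / 2`.
    have hinj : Function.Injective fun (y : Fin n → Bool) i => !(y i) := fun y y' hyy => by
      funext i
      simpa using congrFun hyy i
    rw [← Finset.card_map ⟨_, hinj⟩ (s := S)]
    refine card_mul_card_le _ _ fun x hx y hy => ?_
    obtain ⟨y, hyS, rfl⟩ := Finset.mem_map.1 hy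
    have hle : ¬ n < 2 * hammingDist x y := by
      rw [← compXOR_MAJ_eq_true_iff, h x hx y hyS]
      simp
    have := hammingDist_add_hammingDist_not x y
    simp only [Function.Embedding.coeFn_mk]
    omega

theorem two_rpow_le_size {n : ℕ} (D : LinearDecisionList (Fin n ⊕ Fin n))
    (hD : D.Computes (compXOR (MAJ n))) : (2 : ℝ) ^ ((0.18 : ℝ) * (n : ℝ)) ≤ (D.size : ℝ) := by
  -- The largest side `t` that the bound on monochromatic squares allows.
  obtain ⟨t, ht, hmax⟩ : ∃ t : ℕ, (t : ℝ) ^ 4 * 27 ^ n ≤ 256 ^ n ∧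
      ∀ s : ℕ, (s : ℝ) ^ 4 * 27 ^ n ≤ 256 ^ n → s ≤ t := by
    classical
    have hbound : ∀ s : ℕ, (s : ℝ) ^ 4 * 27 ^ n ≤ 256 ^ n → s ≤ 256 ^ n := fun s hs => by
      have h27 : (1 : ℝ) ≤ 27 ^ n := one_le_pow₀ (by norm_num)
      have h4 : (s : ℝ) ≤ (s : ℝ) ^ 4 := by exact_mod_cast Nat.le_self_pow (by norm_num) s
      have : (s : ℝ) ≤ 256 ^ n :=
        h4.trans ((le_mul_of_one_le_right (by positivity) h27).trans hs)
      exact_mod_cast this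
    refine ⟨Nat.findGreatest (fun s : ℕ => (s : ℝ) ^ 4 * 27 ^ n ≤ 256 ^ n) (256 ^ n), ?_, ?_⟩
    · exact Nat.findGreatest_spec (P := fun s : ℕ => (s : ℝ) ^ 4 * 27 ^ n ≤ 256 ^ n)
        (Nat.zero_le _) (by simp)
    · exact fun s hs => Nat.le_findGreatest (hbound s hs) hs
  have hcard : 2 ^ n ≤ D.size * t := by
    have := D.card_le_size_mul t fun R S b hb => by
      have hRS := card_mul_card_le_of_monochromatic R S b fun x hx y hy =>
        (hD _).symm.trans (hb x hx y hy)
      rw [← min_le_iff]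
      refine hmax _ (le_trans ?_ hRS)
      have hR : ((min R.card S.card : ℕ) : ℝ) ≤ R.card := by exact_mod_cast min_le_left _ _
      have hS : ((min R.card S.card : ℕ) : ℝ) ≤ S.card := by exact_mod_cast min_le_right _ _
      refine mul_le_mul_of_nonneg_right ?_ (by positivity)
      calc ((min R.card S.card : ℕ) : ℝ) ^ 4
          = (((min R.card S.card : ℕ) : ℝ) * (min R.card S.card : ℕ)) ^ 2 := by ring
        _ ≤ _ := by gcongr
    rwa [Fintype.card_fin] at this
  have hsize : (27 / 16 : ℝ) ^ n ≤ (D.size : ℝ) ^ 4 := by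
    have hcard' : ((2 : ℝ) ^ n) ^ 4 ≤ (D.size * t : ℝ) ^ 4 :=
      pow_le_pow_left₀ (by positivity) (by exact_mod_cast hcard) 4
    have h256 : (256 : ℝ) ^ n = 16 ^ n * (2 ^ n) ^ 4 := by
      rw [← pow_mul, mul_comm n 4, pow_mul, ← mul_pow]; norm_num
    have hpos : (0 : ℝ) < (2 ^ n) ^ 4 := by positivity
    rw [div_pow, div_le_iff₀ (by positivity)]
    refine le_of_mul_le_mul_right ?_ hpos
    calc (27 : ℝ) ^ n * (2 ^ n) ^ 4 ≤ 27 ^ n * (D.size * t : ℝ) ^ 4 := by gcongr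
      _ = (D.size : ℝ) ^ 4 * ((t : ℝ) ^ 4 * 27 ^ n) := by ring
      _ ≤ (D.size : ℝ) ^ 4 * (16 ^ n * (2 ^ n) ^ 4) := by rw [← h256]; gcongr
      _ = _ := by ring
  refine le_of_pow_le_pow_left₀ (n := 100) (by norm_num) (by positivity) ?_
  calc ((2 : ℝ) ^ ((0.18 : ℝ) * (n : ℝ))) ^ 100 = (2 ^ 18) ^ n := by
        rw [← Real.rpow_natCast, ← Real.rpow_mul (by norm_num), ← pow_mul, ← Real.rpow_natCast]
        congr 1
        push_cast
        ring
    _ ≤ ((27 / 16) ^ 25) ^ n := by gcongr; norm_num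
    _ = ((27 / 16) ^ n) ^ 25 := by rw [← pow_mul, ← pow_mul, mul_comm]
    _ ≤ ((D.size : ℝ) ^ 4) ^ 25 := by gcongr
    _ = (D.size : ℝ) ^ 100 := by rw [← pow_mul]

end ThresholdCircuits

theorem mainTheorem4 :
    (∃ K : ℕ, ∀ n : ℕ, 1 ≤ n →
      ∃ C : ThresholdCircuits.MajMajCircuit (Fin n ⊕ Fin n),
        C.Computes (ThresholdCircuits.compXOR (ThresholdCircuits.MAJ n)) ∧ C.size ≤ K * n) ∧
    (∀ (n : ℕ) (D : ThresholdCircuits.LinearDecisionList (Fin n ⊕ Fin n)),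
      D.Computes (ThresholdCircuits.compXOR (ThresholdCircuits.MAJ n)) →
        (2 : ℝ) ^ ((0.18 : ℝ) * (n : ℝ)) ≤ (D.size : ℝ)) := by
  refine ⟨⟨12, fun n hn => ⟨ThresholdCircuits.majXorCircuit n,
    ThresholdCircuits.majXorCircuit_computes n, ?_⟩⟩, fun n D hD =>
    ThresholdCircuits.two_rpow_le_size D hD⟩
  rw [ThresholdCircuits.majXorCircuit_size]
  omega
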